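/- **Model.** Let $m,n\ge 1$. An $m$-$n$ arena with fluctuations consists of countably many players $a_1,a_2,\dots$ and infinitely many runs. Player $a_l$ has a strength $X_l\in\mathbb R$ and a coefficient of fluctuations $\rho_l>0$; the pairs $(X_l,\rho_l)$ are i.i.d. In round $k$ of run $q$ his performance is $X_l^{q,k}=X_l+\frac{\rho_l}{\sqrt2}\,\epsilon_l^{q,k}$, where the $\epsilon_l^{q,k}$ are i.i.d. $N(0,1)$, independent of all $(X_l,\rho_l)$. Every run starts with all players in state $(0,0)$. In each round, the players in a state $(i,j)$ with $i<m$, $j<n$ are randomly paired with each other: the pairing does not depend on the fluctuations of the current round or of later ones, and, given that a player is in state $(i,j)$, the pair (strength, coefficient) of his opponent is independent of his own and has the same conditional law. In each match the player with the larger performance moves to $(i+1,j)$, the other one to $(i,j+1)$. A player with $i=m$ or $j=n$ has finished his run. For $0\le i\le m$, $0\le j\le n$, $(i,j)\ne(m,n)$, let $(X_{i,j},\rho_{i,j})$ have the conditional law of a player's strength and coefficient of fluctuations, given that he reaches the state $(i,j)$ in a run. **Theorem.** Suppose that $(X_{0,0},\rho_{0,0})$ is a continuous random vector (it has a joint probability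 density on $\mathbb R^2$). Then for all $0\le i\le m$, $0\le j\le n$, $(i,j)\neq(m,n)$, the law of $(X_{i,j},\rho_{i,j})$ is well defined (every player reaches $(i,j)$ with positive probability, and the conditional law depends neither on the player nor on the run), and $(X_{i,j},\rho_{i,j})$ is a continuous random vector. Let $p_{i,j}$ be any versions of the joint densities, let $\Phi$ be the standard normal distribution function, and put $$W[p](x,a)=\int_0^{\infty}\!\!\int_{-\infty}^{\infty}\Phi\Bigl(\tfrac{x-y}{\sqrt{(a^2+b^2)/2}}\Bigr)p(y,b)\,dy\,db,\qquad L[p](x,a)=\int_0^{\infty}\!\!\int_{-\infty}^{\infty}\Phi\Bigl(\tfrac{y-x}{\sqrt{(a^2+b^2)/2}}\Bigr)p(y,b)\,dy\,db .$$ Then, for almost every $(x,a)\in\mathbb R^2$, $$\begin{aligned} p_{i,0}(x,a)&=2\,p_{i-1,0}(x,a)\,W[p_{i-1,0}](x,a) &&(1\le i\le m-1),\\ p_{0,j}(x,a)&=2\,p_{0,j-1}(x,a)\,L[p_{0,j-1}](x,a) &&(1\le j\le n-1),\\ p_{i,j}(x,a)&=\tfrac{2i}{i+j}\,p_{i-1,j}(x,a)\,W[p_{i-1,j}](x,a)+\tfrac{2j}{i+j}\,p_{i,j-1}(x,a)\,L[p_{i,j-1}](x,a)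 &&(1\le i\le m-1,\ 1\le j\le n-1),\\ p_{m,j}(x,a)&=2\,p_{m-1,j}(x,a)\,W[p_{m-1,j}](x,a) &&(0\le j\le n-1),\\ p_{i,n}(x,a)&=2\,p_{i,n-1}(x,a)\,L[p_{i,n-1}](x,a) &&(0\le i\le m-1). \end{aligned}$$ -/

import Mathlib

open MeasureTheory ProbabilityTheory

/-- The raw data of an arena with fluctuations on a sample space `Ω`. The players are indexed by
`ℕ`; runs and rounds are counted from `0`, so `noise l q k` is the relative fluctuation of player
`l` in the `(k+1)`-st round of run `q`, and `opponent l q k` is the player assigned to `l` in that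
round (its value is irrelevant when `l` does not play). -/
structure Arena (Ω : Type*) where
  strength : ℕ → Ω → ℝ
  coeff : ℕ → Ω → ℝ
  noise : ℕ → ℕ → ℕ → Ω → ℝ
  opponent : ℕ → ℕ → ℕ → Ω → ℕ

namespace Arena

variable {Ω : Type*}

/-- Strength and coefficient of fluctuations of player `l`. -/
def attr (A : Arena Ω) (l : ℕ) (ω : Ω) : ℝ × ℝ := (A.strength l ω, A.coeff l ω)

/-- The performance of player `l` in the `(k+1)`-st round of run `q`. -/
noncomputable def performance (A : Arena Ω) (l q k : ℕ) (ω : Ω) : ℝ :=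
  A.strength l ω + A.coeff l ω / √2 * A.noise l q k ω

/-- Player `l` wins against `l'`: strictly better performance. In case of a tie the player with the
smaller index loses, so that every match has exactly one winner. -/
def Wins (A : Arena Ω) (l l' q k : ℕ) (ω : Ω) : Prop :=
  A.performance l' q k ω < A.performance l q k ω ∨
    (A.performance l' q k ω = A.performance l q k ω ∧ l' < l)

open Classical in
/-- `A.state m n q k ω l` is the state of player `l` after `k` rounds of run `q` of the
`m`-`n` arena. States `(i, j)` with `i = m` or `j = n` are final. -/
noncomputable def state (A : Arena Ω) (m n q : ℕ) : ℕ → Ω → ℕ → ℕ × ℕ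
  | 0, _, _ => (0, 0)
  | k + 1, ω, l =>
    let s := A.state m n q k ω l
    if s.1 < m ∧ s.2 < n then
      if A.Wins l (A.opponent l q k ω) q k ω then (s.1 + 1, s.2) else (s.1, s.2 + 1)
    else s

/-- The event that player `l` reaches the state `(i, j)` in run `q`, that is, that `l` belongs to
the set of players whose state after `i + j` rounds is `(i, j)`. -/
def reach (A : Arena Ω) (m n l q i j : ℕ) : Set Ω :=
  {ω | A.state m n q (i + j) ω l = (i, j)}

variable [MeasurableSpace Ω]

/-- What is determined just before the performances of round `k + 1` of run `q`: all strengths and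
coefficients, the fluctuations of all earlier rounds, and all assignments up to and including the
assignment for this round. -/
@[reducible]
def past (A : Arena Ω) (q k : ℕ) : MeasurableSpace Ω :=
  (⨆ l : ℕ, MeasurableSpace.comap (A.attr l) inferInstance) ⊔
  (⨆ (l : ℕ) (q' : ℕ) (k' : ℕ) (_ : q' < q ∨ (q' = q ∧ k' < k)),
    MeasurableSpace.comap (A.noise l q' k') inferInstance) ⊔
  (⨆ (l : ℕ) (q' : ℕ) (k' : ℕ) (_ : q' < q ∨ (q' = q ∧ k' ≤ k)),
    MeasurableSpace.comap (A.opponent l q' k') inferInstance)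

/-- The model assumptions of an `m`-`n` arena with fluctuations. -/
structure IsArena (A : Arena Ω) (P : Measure Ω) (m n : ℕ) : Prop where
  measurable_strength : ∀ l, Measurable (A.strength l)
  measurable_coeff : ∀ l, Measurable (A.coeff l)
  measurable_noise : ∀ l q k, Measurable (A.noise l q k)
  measurable_opponent : ∀ l q k, Measurable (A.opponent l q k)
  coeff_pos : ∀ l, ∀ᵐ ω ∂P, 0 < A.coeff l ω
  /-- The pairs (strength, coefficient) of the players are i.i.d. -/
  attr_indep : iIndepFun (fun l => A.attr l) P
  attr_ident : ∀ l, IdentDistrib (A.attr l) (A.attr 0) P P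
  /-- The relative fluctuations are i.i.d. standard normal, and independent of the players'
  strengths and coefficients. -/
  noise_law : ∀ l q k, P.map (A.noise l q k) = gaussianReal 0 1
  noise_indep : iIndepFun (fun t : ℕ × ℕ × ℕ => A.noise t.1 t.2.1 t.2.2) P
  attr_noise_indep : IndepFun (fun ω (l : ℕ) => A.attr l ω)
    (fun ω (t : ℕ × ℕ × ℕ) => A.noise t.1 t.2.1 t.2.2 ω) P
  /-- Opponents are assigned without looking ahead: the fluctuations of a round are independent of
  everything that is determined before the matches of that round. -/
  noise_fresh : ∀ q k, Indep (A.past q k)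
    (⨆ l : ℕ, MeasurableSpace.comap (A.noise l q k) inferInstance) P
  /-- In each round the players who are still playing are paired, within their states. -/
  matching : ∀ q k, ∀ᵐ ω ∂P, ∀ l,
    (A.state m n q k ω l).1 < m → (A.state m n q k ω l).2 < n →
      A.opponent l q k ω ≠ l ∧
      A.opponent (A.opponent l q k ω) q k ω = l ∧
      A.state m n q k ω (A.opponent l q k ω) = A.state m n q k ω l
  /-- The pairing is random: given that player `l` is in the state `(i, j)`, the strength and
  coefficient of the opponent drawn for `l` are those of an independently drawn player in that
  state. -/
  random_assignment : ∀ l q i j, i < m → j < n →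
    IndepFun (A.attr l) (fun ω => A.attr (A.opponent l q (i + j) ω) ω)
      (cond P (A.reach m n l q i j)) ∧
    IdentDistrib (fun ω => A.attr (A.opponent l q (i + j) ω) ω) (A.attr l)
      (cond P (A.reach m n l q i j)) (cond P (A.reach m n l q i j))

/-- The law of `(X_{i,j}, ρ_{i,j})`: the conditional law of the strength and coefficient of player
`l`, given that `l` reaches the state `(i, j)` in run `q`. -/
noncomputable def law (A : Arena Ω) (P : Measure Ω) (m n l q i j : ℕ) : Measure (ℝ × ℝ) :=
  (cond P (A.reach m n l q i j)).map (A.attr l)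

end Arena

/-- `p` is a joint probability density function of the law `ν` on `ℝ²`. -/
def IsJointPDF (p : ℝ × ℝ → ℝ) (ν : Measure (ℝ × ℝ)) : Prop :=
  IsProbabilityMeasure ν ∧ Measurable p ∧ (∀ z, 0 ≤ p z) ∧
    ν = (volume : Measure (ℝ × ℝ)).withDensity (fun z => ENNReal.ofReal (p z))

/-- `ν` is the law of a continuous random vector in `ℝ²`. -/
def IsContinuousLaw (ν : Measure (ℝ × ℝ)) : Prop := ∃ p, IsJointPDF p ν

/-- The standard normal distribution function. -/
noncomputable def stdNormalCDF (t : ℝ) : ℝ := cdf (gaussianReal 0 1) t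

/-- `∫∫ Φ((x - y) / √((a² + b²) / 2)) p(y, b) dy db` over `y ∈ ℝ`, `b > 0`. -/
noncomputable def winIntegral (p : ℝ × ℝ → ℝ) (x a : ℝ) : ℝ :=
  ∫ b in Set.Ioi (0 : ℝ), ∫ y : ℝ, stdNormalCDF ((x - y) / √((a ^ 2 + b ^ 2) / 2)) * p (y, b)

/-- `∫∫ Φ((y - x) / √((a² + b²) / 2)) p(y, b) dy db` over `y ∈ ℝ`, `b > 0`. -/
noncomputable def loseIntegral (p : ℝ × ℝ → ℝ) (x a : ℝ) : ℝ :=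
  ∫ b in Set.Ioi (0 : ℝ), ∫ y : ℝ, stdNormalCDF ((y - x) / √((a ^ 2 + b ^ 2) / 2)) * p (y, b)

open scoped ENNReal NNReal

theorem stdNormalCDF_nonneg (t : ℝ) : 0 ≤ stdNormalCDF t := cdf_nonneg _ _

theorem stdNormalCDF_le_one (t : ℝ) : stdNormalCDF t ≤ 1 := cdf_le_one _ _

theorem measurable_stdNormalCDF : Measurable stdNormalCDF :=
  (monotone_cdf (gaussianReal 0 1)).measurable

/-- The variance of the difference of two performances, given the coefficients `a` and `b`. -/
noncomputable def gapVariance (a b : ℝ) : ℝ≥0 :=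
  NNReal.mk ((a ^ 2 + b ^ 2) / 2) (by positivity)

/-- The joint law of the relative fluctuations of the two participants of a match. -/
noncomputable def noisePairLaw : Measure (ℝ × ℝ) := (gaussianReal 0 1).prod (gaussianReal 0 1)

instance : IsProbabilityMeasure noisePairLaw := by unfold noisePairLaw; infer_instance

/-- The performance with strength and coefficient `z` and relative fluctuation `e`. -/
noncomputable def perf (z : ℝ × ℝ) (e : ℝ) : ℝ := z.1 + z.2 / √2 * e

theorem map_perf (z : ℝ × ℝ) :
    (gaussianReal 0 1).map (perf z) = gaussianReal z.1 (NNReal.mk (z.2 ^ 2 / 2) (by positivity)) := by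
  have h : perf z = (fun x => z.1 + x) ∘ fun x => z.2 / √2 * x := rfl
  rw [h, ← Measure.map_map (by fun_prop) (by fun_prop), gaussianReal_map_const_mul,
    gaussianReal_map_const_add]
  congr 1
  · simp
  · ext
    simp [div_pow]

@[fun_prop]
theorem measurable_perf {α : Type*} [MeasurableSpace α] {f : α → ℝ × ℝ} {g : α → ℝ}
    (hf : Measurable f) (hg : Measurable g) : Measurable fun x => perf (f x) (g x) := by
  unfold perf
  fun_prop

theorem map_perf_sub_perf (z z' : ℝ × ℝ) :
    noisePairLaw.map (fun e => perf z e.1 - perf z' e.2) =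
      gaussianReal (z.1 - z'.1) (gapVariance z.2 z'.2) := by
  have h : (fun e : ℝ × ℝ => perf z e.1 - perf z' e.2) =
      (fun x : ℝ × ℝ => x.1 + x.2) ∘ Prod.map (perf z) (Neg.neg ∘ perf z') := by
    ext e; simp [sub_eq_add_neg]
  have hm : ∀ z, Measurable (perf z) := fun z => measurable_perf measurable_const measurable_id
  rw [h, ← Measure.map_map (by fun_prop) ((hm z).prodMap (measurable_neg.comp (hm z'))),
    noisePairLaw, ← Measure.map_prod_map _ _ (hm z) (measurable_neg.comp (hm z')),
    ← Measure.map_map measurable_neg (hm z'), map_perf, map_perf,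
    show (Neg.neg : ℝ → ℝ) = fun x => -x from rfl, gaussianReal_map_neg]
  change gaussianReal _ _ ∗ gaussianReal _ _ = _
  rw [gaussianReal_conv_gaussianReal]
  congr 1
  ext
  change z.2 ^ 2 / 2 + z'.2 ^ 2 / 2 = (z.2 ^ 2 + z'.2 ^ 2) / 2
  ring

theorem gaussianReal_eq_map_standard (μ : ℝ) (v : ℝ≥0) :
    gaussianReal μ v = (gaussianReal 0 1).map (fun x => μ + √v * x) := by
  have h : (fun x => μ + √v * x) = (fun x => μ + x) ∘ fun x => √v * x := rfl
  rw [h, ← Measure.map_map (by fun_prop) (by fun_prop), gaussianReal_map_const_mul,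
    gaussianReal_map_const_add]
  congr 1
  · simp
  · ext
    simp

theorem gaussianReal_Iio_zero (μ : ℝ) {v : ℝ≥0} (hv : v ≠ 0) :
    gaussianReal μ v (Set.Iio 0) = ENNReal.ofReal (stdNormalCDF (-μ / √v)) := by
  have := nullSingletonClass_gaussianReal (μ := (0 : ℝ)) (v := 1) one_ne_zero
  have hv' : 0 < √(v : ℝ) := by positivity
  rw [gaussianReal_eq_map_standard, Measure.map_apply (by fun_prop) measurableSet_Iio,
    stdNormalCDF, ofReal_cdf, measure_congr Iio_ae_eq_Iic.symm]
  congr 1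
  ext x
  simp only [Set.mem_preimage, Set.mem_Iio, lt_div_iff₀ hv']
  constructor <;> intro h <;> linarith

/-- The probability that a player with strength and coefficient `z` beats one with `z'`. -/
noncomputable def winProb (z z' : ℝ × ℝ) : ℝ :=
  stdNormalCDF ((z.1 - z'.1) / √((z.2 ^ 2 + z'.2 ^ 2) / 2))

theorem winProb_nonneg (z z' : ℝ × ℝ) : 0 ≤ winProb z z' := stdNormalCDF_nonneg _

theorem winProb_le_one (z z' : ℝ × ℝ) : winProb z z' ≤ 1 := stdNormalCDF_le_one _

@[fun_prop]
theorem measurable_winProb : Measurable fun x : (ℝ × ℝ) × (ℝ × ℝ) => winProb x.1 x.2 := by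
  unfold winProb
  exact measurable_stdNormalCDF.comp (by fun_prop)

theorem gapVariance_ne_zero {a b : ℝ} (ha : 0 < a) : gapVariance a b ≠ 0 := by
  have : (0 : ℝ) < (a ^ 2 + b ^ 2) / 2 := by positivity
  intro h
  exact this.ne' (congrArg NNReal.toReal h)

theorem noisePairLaw_lt {z z' : ℝ × ℝ} (hz : 0 < z.2) :
    noisePairLaw {e | perf z' e.2 < perf z e.1} = ENNReal.ofReal (winProb z z') := by
  have h := gaussianReal_Iio_zero (z'.1 - z.1) (gapVariance_ne_zero (b := z'.2) hz)
  rw [← neg_sub, ← gaussianReal_map_neg, ← map_perf_sub_perf,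
    Measure.map_map measurable_neg (by fun_prop),
    Measure.map_apply (measurable_neg.comp (by fun_prop)) measurableSet_Iio] at h
  convert h using 2
  · ext e
    simp
  · simp only [winProb, gapVariance, NNReal.coe_mk, neg_neg]

theorem noisePairLaw_gt {z z' : ℝ × ℝ} (hz : 0 < z.2) :
    noisePairLaw {e | perf z e.1 < perf z' e.2} = ENNReal.ofReal (winProb z' z) := by
  have h := gaussianReal_Iio_zero (z.1 - z'.1) (gapVariance_ne_zero (b := z'.2) hz)
  rw [← map_perf_sub_perf, Measure.map_apply (by fun_prop) measurableSet_Iio] at h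
  convert h using 2
  · ext e
    simp
  · simp only [winProb, gapVariance, NNReal.coe_mk, neg_sub, add_comm]

theorem noisePairLaw_eq {z z' : ℝ × ℝ} (hz : 0 < z.2) :
    noisePairLaw {e | perf z e.1 = perf z' e.2} = 0 := by
  have := nullSingletonClass_gaussianReal (μ := z.1 - z'.1) (gapVariance_ne_zero (b := z'.2) hz)
  have h : gaussianReal (z.1 - z'.1) (gapVariance z.2 z'.2) {0} = 0 := measure_singleton 0
  rw [← map_perf_sub_perf, Measure.map_apply (by fun_prop) (measurableSet_singleton 0)] at h
  convert h using 2
  ext e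
  simp [sub_eq_zero]

/-- `winMeasure ν` is the law of the winner of a match between two independent players
with law `ν`. -/
noncomputable def winMeasure (ν : Measure (ℝ × ℝ)) : Measure (ℝ × ℝ) :=
  ν.withDensity fun z => 2 * ∫⁻ z', ENNReal.ofReal (winProb z z') ∂ν

/-- `loseMeasure ν` is the law of the loser of a match between two independent players
with law `ν`. -/
noncomputable def loseMeasure (ν : Measure (ℝ × ℝ)) : Measure (ℝ × ℝ) :=
  ν.withDensity fun z => 2 * ∫⁻ z', ENNReal.ofReal (winProb z' z) ∂ν

theorem measurable_lintegral_winProb_left (ν : Measure (ℝ × ℝ)) [SFinite ν] :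
    Measurable fun z => ∫⁻ z', ENNReal.ofReal (winProb z z') ∂ν :=
  Measurable.lintegral_prod_right' (f := fun x : (ℝ × ℝ) × (ℝ × ℝ) =>
    ENNReal.ofReal (winProb x.1 x.2)) (by fun_prop)

theorem measurable_lintegral_winProb_right (ν : Measure (ℝ × ℝ)) [SFinite ν] :
    Measurable fun z => ∫⁻ z', ENNReal.ofReal (winProb z' z) ∂ν :=
  Measurable.lintegral_prod_left' (f := fun x : (ℝ × ℝ) × (ℝ × ℝ) =>
    ENNReal.ofReal (winProb x.1 x.2)) (by fun_prop)

theorem two_mul_prod_win_eq {ν : Measure (ℝ × ℝ)} [IsProbabilityMeasure ν]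
    (hν : ∀ᵐ z ∂ν, 0 < z.2) {S : Set (ℝ × ℝ)} (hS : MeasurableSet S) :
    2 * ((ν.prod ν).prod noisePairLaw)
      {x | x.1.1 ∈ S ∧ perf x.1.2 x.2.2 < perf x.1.1 x.2.1} = winMeasure ν S := by
  rw [winMeasure, withDensity_apply _ hS,
    lintegral_const_mul _ (measurable_lintegral_winProb_left ν)]
  congr 1
  have hlt : MeasurableSet {x : ((ℝ × ℝ) × (ℝ × ℝ)) × (ℝ × ℝ) |
      perf x.1.2 x.2.2 < perf x.1.1 x.2.1} := measurableSet_lt (by fun_prop) (by fun_prop)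
  have hT : MeasurableSet {x : ((ℝ × ℝ) × (ℝ × ℝ)) × (ℝ × ℝ) |
      x.1.1 ∈ S ∧ perf x.1.2 x.2.2 < perf x.1.1 x.2.1} :=
    (hS.preimage (measurable_fst.comp measurable_fst)).inter hlt
  rw [Measure.prod_apply hT, lintegral_prod _ (measurable_measure_prodMk_left hT).aemeasurable,
    ← lintegral_indicator hS]
  refine lintegral_congr_ae ?_
  filter_upwards [hν] with z hz
  by_cases h : z ∈ S
  · simp only [Set.preimage_ofPred_eq, h, true_and, Set.indicator_of_mem, noisePairLaw_lt hz]
  · simp [h]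

theorem two_mul_prod_lose_eq {ν : Measure (ℝ × ℝ)} [IsProbabilityMeasure ν]
    (hν : ∀ᵐ z ∂ν, 0 < z.2) {S : Set (ℝ × ℝ)} (hS : MeasurableSet S) :
    2 * ((ν.prod ν).prod noisePairLaw)
      {x | x.1.1 ∈ S ∧ perf x.1.1 x.2.1 < perf x.1.2 x.2.2} = loseMeasure ν S := by
  rw [loseMeasure, withDensity_apply _ hS,
    lintegral_const_mul _ (measurable_lintegral_winProb_right ν)]
  congr 1
  have hlt : MeasurableSet {x : ((ℝ × ℝ) × (ℝ × ℝ)) × (ℝ × ℝ) |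
      perf x.1.1 x.2.1 < perf x.1.2 x.2.2} := measurableSet_lt (by fun_prop) (by fun_prop)
  have hT : MeasurableSet {x : ((ℝ × ℝ) × (ℝ × ℝ)) × (ℝ × ℝ) |
      x.1.1 ∈ S ∧ perf x.1.1 x.2.1 < perf x.1.2 x.2.2} :=
    (hS.preimage (measurable_fst.comp measurable_fst)).inter hlt
  rw [Measure.prod_apply hT, lintegral_prod _ (measurable_measure_prodMk_left hT).aemeasurable,
    ← lintegral_indicator hS]
  refine lintegral_congr_ae ?_
  filter_upwards [hν] with z hz
  by_cases h : z ∈ S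
  · simp only [Set.preimage_ofPred_eq, h, true_and, Set.indicator_of_mem, noisePairLaw_gt hz]
  · simp [h]

theorem prod_tie_eq_zero {ν : Measure (ℝ × ℝ)} [IsProbabilityMeasure ν]
    (hν : ∀ᵐ z ∂ν, 0 < z.2) :
    ((ν.prod ν).prod noisePairLaw) {x | perf x.1.1 x.2.1 = perf x.1.2 x.2.2} = 0 := by
  have hT : MeasurableSet {x : ((ℝ × ℝ) × (ℝ × ℝ)) × (ℝ × ℝ) |
      perf x.1.1 x.2.1 = perf x.1.2 x.2.2} :=
    measurableSet_eq_fun (by fun_prop) (by fun_prop)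
  rw [Measure.prod_apply hT, lintegral_prod _ (measurable_measure_prodMk_left hT).aemeasurable,
    lintegral_eq_zero_iff' (by
      exact (Measurable.lintegral_prod_right' (measurable_measure_prodMk_left hT)).aemeasurable)]
  filter_upwards [hν] with z hz
  simp [noisePairLaw_eq hz]

theorem winMeasure_univ_eq_loseMeasure_univ (ν : Measure (ℝ × ℝ)) [IsProbabilityMeasure ν] :
    winMeasure ν Set.univ = loseMeasure ν Set.univ := by
  rw [winMeasure, loseMeasure, withDensity_apply _ .univ, withDensity_apply _ .univ,
    lintegral_const_mul _ (measurable_lintegral_winProb_right ν),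
    lintegral_const_mul _ (measurable_lintegral_winProb_left ν), Measure.restrict_univ,
    lintegral_lintegral_swap]
  exact (measurable_winProb.ennreal_ofReal).aemeasurable

theorem winMeasure_univ {ν : Measure (ℝ × ℝ)} [IsProbabilityMeasure ν]
    (hν : ∀ᵐ z ∂ν, 0 < z.2) : winMeasure ν Set.univ = 1 := by
  set κ := (ν.prod ν).prod noisePairLaw
  set W := {x : ((ℝ × ℝ) × (ℝ × ℝ)) × (ℝ × ℝ) | perf x.1.2 x.2.2 < perf x.1.1 x.2.1}
  set T := {x : ((ℝ × ℝ) × (ℝ × ℝ)) × (ℝ × ℝ) | perf x.1.1 x.2.1 < perf x.1.2 x.2.2}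
  have h1 : 2 * κ W = winMeasure ν Set.univ := by
    rw [← two_mul_prod_win_eq hν .univ]; simp [W, κ]
  have h2 : 2 * κ T = loseMeasure ν Set.univ := by
    rw [← two_mul_prod_lose_eq hν .univ]; simp [T, κ]
  have hWm : MeasurableSet W := measurableSet_lt (by fun_prop) (by fun_prop)
  have h3 : κ Wᶜ = κ T := by
    have h0 : ∀ᵐ x ∂κ, ¬ perf x.1.1 x.2.1 = perf x.1.2 x.2.2 := by
      rw [ae_iff]; simpa using prod_tie_eq_zero hν
    refine measure_congr (Filter.eventuallyEq_set.2 ?_)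
    filter_upwards [h0] with x hx
    simp only [W, T, Set.mem_compl_iff, Set.mem_ofPred_eq, not_lt]
    exact ⟨fun h => lt_of_le_of_ne h hx, le_of_lt⟩
  have h4 : κ W + κ Wᶜ = 1 := prob_add_prob_compl hWm
  have h5 : κ W = κ T := by
    have := h1.trans ((winMeasure_univ_eq_loseMeasure_univ ν).trans h2.symm)
    exact (ENNReal.mul_right_inj two_ne_zero (by simp)).1 this
  rw [h3, ← h5, ← two_mul] at h4
  rw [← h1, h4]

theorem loseMeasure_univ {ν : Measure (ℝ × ℝ)} [IsProbabilityMeasure ν]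
    (hν : ∀ᵐ z ∂ν, 0 < z.2) : loseMeasure ν Set.univ = 1 :=
  (winMeasure_univ_eq_loseMeasure_univ ν).symm.trans (winMeasure_univ hν)

theorem IsJointPDF.integrable {p : ℝ × ℝ → ℝ} {ν : Measure (ℝ × ℝ)} (h : IsJointPDF p ν) :
    Integrable p := by
  obtain ⟨hν, hp, hp0, rfl⟩ := h
  refine ⟨hp.aestronglyMeasurable, ?_⟩
  rw [hasFiniteIntegral_iff_ofReal (Filter.Eventually.of_forall hp0), ← setLIntegral_univ,
    ← withDensity_apply _ .univ, hν.measure_univ]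
  exact ENNReal.one_lt_top

theorem IsJointPDF.ae_eq_zero_of_nonpos {p : ℝ × ℝ → ℝ} {ν : Measure (ℝ × ℝ)}
    (h : IsJointPDF p ν) (hν : ∀ᵐ z ∂ν, 0 < z.2) : ∀ᵐ z, z.2 ≤ 0 → p z = 0 := by
  obtain ⟨-, hp, hp0, rfl⟩ := h
  rw [ae_withDensity_iff (by fun_prop)] at hν
  filter_upwards [hν] with z hz hz2
  by_contra hne
  have : 0 < p z := lt_of_le_of_ne (hp0 z) (Ne.symm hne)
  exact absurd (hz (by simpa using this)) (not_lt.2 hz2)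

/-- Integration of a bounded function against a law on the upper half plane with a density, as
an iterated integral. -/
theorem IsJointPDF.lintegral_eq_iterated {p : ℝ × ℝ → ℝ} {ν : Measure (ℝ × ℝ)}
    (h : IsJointPDF p ν) (hν : ∀ᵐ z ∂ν, 0 < z.2) {f : ℝ × ℝ → ℝ} (hf : Measurable f)
    (hf0 : ∀ z, 0 ≤ f z) (hf1 : ∀ z, f z ≤ 1) :
    ∫⁻ z, ENNReal.ofReal (f z) ∂ν =
      ENNReal.ofReal (∫ b in Set.Ioi (0 : ℝ), ∫ y : ℝ, f (y, b) * p (y, b)) := by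
  have hint : Integrable fun z => f z * p z :=
    h.integrable.bdd_mul (c := 1) hf.aestronglyMeasurable
      (Filter.Eventually.of_forall fun z => by
        rw [Real.norm_of_nonneg (hf0 z)]; exact hf1 z)
  have hzero := h.ae_eq_zero_of_nonpos hν
  obtain ⟨-, hp, hp0, rfl⟩ := h
  have hS : {z : ℝ × ℝ | 0 < z.2} = Set.univ ×ˢ Set.Ioi 0 := by ext; simp
  have h1 : ∫ z, f z * p z = ∫ b in Set.Ioi (0 : ℝ), ∫ y : ℝ, f (y, b) * p (y, b) := by
    rw [← setIntegral_eq_integral_of_ae_compl_eq_zero (s := {z : ℝ × ℝ | 0 < z.2}), hS,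
      Measure.volume_eq_prod, ← Measure.prod_restrict, Measure.restrict_univ, integral_prod_symm]
    · have := hint.integrableOn (s := Set.univ ×ˢ Set.Ioi 0)
      rwa [IntegrableOn, Measure.volume_eq_prod, ← Measure.prod_restrict,
        Measure.restrict_univ] at this
    · filter_upwards [hzero] with z hz hz'
      rw [hz (not_lt.1 hz'), mul_zero]
  rw [← h1, ofReal_integral_eq_lintegral_ofReal hint
    (Filter.Eventually.of_forall fun z => mul_nonneg (hf0 z) (hp0 z)),
    lintegral_withDensity_eq_lintegral_mul _ (by fun_prop) (by fun_prop)]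
  refine lintegral_congr fun z => ?_
  rw [Pi.mul_apply, mul_comm, ENNReal.ofReal_mul (hf0 z)]

theorem IsJointPDF.lintegral_winProb_left {p : ℝ × ℝ → ℝ} {ν : Measure (ℝ × ℝ)}
    (h : IsJointPDF p ν) (hν : ∀ᵐ z ∂ν, 0 < z.2) (z : ℝ × ℝ) :
    ∫⁻ z', ENNReal.ofReal (winProb z z') ∂ν = ENNReal.ofReal (winIntegral p z.1 z.2) :=
  h.lintegral_eq_iterated hν (measurable_winProb.comp measurable_prodMk_left)
    (winProb_nonneg z) (winProb_le_one z)

theorem IsJointPDF.lintegral_winProb_right {p : ℝ × ℝ → ℝ} {ν : Measure (ℝ × ℝ)}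
    (h : IsJointPDF p ν) (hν : ∀ᵐ z ∂ν, 0 < z.2) (z : ℝ × ℝ) :
    ∫⁻ z', ENNReal.ofReal (winProb z' z) ∂ν = ENNReal.ofReal (loseIntegral p z.1 z.2) := by
  rw [h.lintegral_eq_iterated (f := fun z' => winProb z' z) hν
    (measurable_winProb.comp measurable_prodMk_right) (fun z' => winProb_nonneg z' z)
    (fun z' => winProb_le_one z' z)]
  simp only [winProb, loseIntegral, add_comm]

theorem winIntegral_nonneg {p : ℝ × ℝ → ℝ} (hp : ∀ z, 0 ≤ p z) (x a : ℝ) :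
    0 ≤ winIntegral p x a :=
  integral_nonneg fun _ => integral_nonneg fun _ => mul_nonneg (stdNormalCDF_nonneg _) (hp _)

theorem loseIntegral_nonneg {p : ℝ × ℝ → ℝ} (hp : ∀ z, 0 ≤ p z) (x a : ℝ) :
    0 ≤ loseIntegral p x a :=
  integral_nonneg fun _ => integral_nonneg fun _ => mul_nonneg (stdNormalCDF_nonneg _) (hp _)

theorem IsJointPDF.measurable_winIntegral {p : ℝ × ℝ → ℝ} {ν : Measure (ℝ × ℝ)}
    (h : IsJointPDF p ν) (hν : ∀ᵐ z ∂ν, 0 < z.2) :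
    Measurable fun z : ℝ × ℝ => winIntegral p z.1 z.2 := by
  have := h.1
  have hm := (measurable_lintegral_winProb_left ν).ennreal_toReal
  simp_rw [h.lintegral_winProb_left hν, ENNReal.toReal_ofReal (winIntegral_nonneg h.2.2.1 _ _)] at hm
  exact hm

theorem IsJointPDF.measurable_loseIntegral {p : ℝ × ℝ → ℝ} {ν : Measure (ℝ × ℝ)}
    (h : IsJointPDF p ν) (hν : ∀ᵐ z ∂ν, 0 < z.2) :
    Measurable fun z : ℝ × ℝ => loseIntegral p z.1 z.2 := by
  have := h.1
  have hm := (measurable_lintegral_winProb_right ν).ennreal_toReal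
  simp_rw [h.lintegral_winProb_right hν, ENNReal.toReal_ofReal (loseIntegral_nonneg h.2.2.1 _ _)] at hm
  exact hm

theorem IsJointPDF.winMeasure_eq {p : ℝ × ℝ → ℝ} {ν : Measure (ℝ × ℝ)}
    (h : IsJointPDF p ν) (hν : ∀ᵐ z ∂ν, 0 < z.2) :
    winMeasure ν = volume.withDensity fun z =>
      ENNReal.ofReal (2 * p z * winIntegral p z.1 z.2) := by
  have hW := h.measurable_winIntegral hν
  simp_rw [winMeasure, h.lintegral_winProb_left hν]
  obtain ⟨-, hp, hp0, hd⟩ := h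
  rw [hd, ← withDensity_mul _ (by fun_prop) (by fun_prop)]
  congr 1 with z
  rw [Pi.mul_apply, mul_comm 2 (p z), mul_assoc, ENNReal.ofReal_mul (hp0 z),
    ENNReal.ofReal_mul zero_le_two, ENNReal.ofReal_ofNat]

theorem IsJointPDF.loseMeasure_eq {p : ℝ × ℝ → ℝ} {ν : Measure (ℝ × ℝ)}
    (h : IsJointPDF p ν) (hν : ∀ᵐ z ∂ν, 0 < z.2) :
    loseMeasure ν = volume.withDensity fun z =>
      ENNReal.ofReal (2 * p z * loseIntegral p z.1 z.2) := by
  have hW := h.measurable_loseIntegral hν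
  simp_rw [loseMeasure, h.lintegral_winProb_right hν]
  obtain ⟨-, hp, hp0, hd⟩ := h
  rw [hd, ← withDensity_mul _ (by fun_prop) (by fun_prop)]
  congr 1 with z
  rw [Pi.mul_apply, mul_comm 2 (p z), mul_assoc, ENNReal.ofReal_mul (hp0 z),
    ENNReal.ofReal_mul zero_le_two, ENNReal.ofReal_ofNat]

/-- Densities of the same law agree almost everywhere. -/
theorem IsJointPDF.ae_eq {p g : ℝ × ℝ → ℝ} {ν : Measure (ℝ × ℝ)} (h : IsJointPDF p ν)
    (hg : Measurable g) (hg0 : ∀ z, 0 ≤ g z)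
    (hν : ν = volume.withDensity fun z => ENNReal.ofReal (g z)) : ∀ᵐ z, p z = g z := by
  obtain ⟨-, hp, hp0, hd⟩ := h
  rw [hd, withDensity_eq_iff_of_sigmaFinite (by fun_prop) (by fun_prop)] at hν
  filter_upwards [hν] with z hz
  exact (ENNReal.ofReal_eq_ofReal_iff (hp0 z) (hg0 z)).1 hz

theorem IsJointPDF.ae_eq_win {p p' : ℝ × ℝ → ℝ} {ν ν' : Measure (ℝ × ℝ)}
    (h : IsJointPDF p ν) (h' : IsJointPDF p' ν') (hpos : ∀ᵐ z ∂ν, 0 < z.2)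
    (hν : ν' = winMeasure ν) : ∀ᵐ z, p' z = 2 * p z * winIntegral p z.1 z.2 := by
  have hW := h.measurable_winIntegral hpos
  have hp := h.2.1
  have hp0 := h.2.2.1
  exact h'.ae_eq (by fun_prop) (fun z => mul_nonneg (mul_nonneg zero_le_two (hp0 z))
    (winIntegral_nonneg hp0 _ _)) (hν.trans (h.winMeasure_eq hpos))

theorem IsJointPDF.ae_eq_lose {p p' : ℝ × ℝ → ℝ} {ν ν' : Measure (ℝ × ℝ)}
    (h : IsJointPDF p ν) (h' : IsJointPDF p' ν') (hpos : ∀ᵐ z ∂ν, 0 < z.2)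
    (hν : ν' = loseMeasure ν) : ∀ᵐ z, p' z = 2 * p z * loseIntegral p z.1 z.2 := by
  have hW := h.measurable_loseIntegral hpos
  have hp := h.2.1
  have hp0 := h.2.2.1
  exact h'.ae_eq (by fun_prop) (fun z => mul_nonneg (mul_nonneg zero_le_two (hp0 z))
    (loseIntegral_nonneg hp0 _ _)) (hν.trans (h.loseMeasure_eq hpos))

theorem IsJointPDF.ae_eq_mix {p₁ p₂ p' : ℝ × ℝ → ℝ} {ν₁ ν₂ ν' : Measure (ℝ × ℝ)}
    (h₁ : IsJointPDF p₁ ν₁) (h₂ : IsJointPDF p₂ ν₂) (h' : IsJointPDF p' ν')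
    (hpos₁ : ∀ᵐ z ∂ν₁, 0 < z.2) (hpos₂ : ∀ᵐ z ∂ν₂, 0 < z.2) {s t : ℝ} (hs : 0 ≤ s) (ht : 0 ≤ t)
    (hν : ν' = ENNReal.ofReal s • winMeasure ν₁ + ENNReal.ofReal t • loseMeasure ν₂) :
    ∀ᵐ z, p' z = s * (2 * p₁ z * winIntegral p₁ z.1 z.2) +
      t * (2 * p₂ z * loseIntegral p₂ z.1 z.2) := by
  have hW := h₁.measurable_winIntegral hpos₁
  have hL := h₂.measurable_loseIntegral hpos₂
  have hp₁ := h₁.2.1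
  have hp₂ := h₂.2.1
  have h0₁ : ∀ z : ℝ × ℝ, 0 ≤ s * (2 * p₁ z * winIntegral p₁ z.1 z.2) := fun z =>
    mul_nonneg hs (mul_nonneg (mul_nonneg zero_le_two (h₁.2.2.1 z))
      (winIntegral_nonneg h₁.2.2.1 _ _))
  have h0₂ : ∀ z : ℝ × ℝ, 0 ≤ t * (2 * p₂ z * loseIntegral p₂ z.1 z.2) := fun z =>
    mul_nonneg ht (mul_nonneg (mul_nonneg zero_le_two (h₂.2.2.1 z))
      (loseIntegral_nonneg h₂.2.2.1 _ _))
  refine h'.ae_eq (by fun_prop) (fun z => add_nonneg (h0₁ z) (h0₂ z)) ?_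
  rw [hν, h₁.winMeasure_eq hpos₁, h₂.loseMeasure_eq hpos₂,
    ← withDensity_smul _ (by fun_prop), ← withDensity_smul _ (by fun_prop),
    ← withDensity_add_left (by fun_prop)]
  congr 1 with z
  simp only [Pi.add_apply, Pi.smul_apply, smul_eq_mul]
  rw [ENNReal.ofReal_add (h0₁ z) (h0₂ z), ENNReal.ofReal_mul hs, ENNReal.ofReal_mul ht]

theorem isContinuousLaw_iff {ν : Measure (ℝ × ℝ)} [IsProbabilityMeasure ν] :
    IsContinuousLaw ν ↔ ν ≪ volume := by
  constructor
  · rintro ⟨p, -, -, -, rfl⟩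
    exact withDensity_absolutelyContinuous _ _
  · intro h
    refine ⟨fun z => (ν.rnDeriv volume z).toReal, inferInstance, by fun_prop,
      fun _ => ENNReal.toReal_nonneg, ?_⟩
    conv_lhs => rw [← Measure.withDensity_rnDeriv_eq ν volume h]
    refine withDensity_congr_ae ?_
    filter_upwards [Measure.rnDeriv_lt_top ν volume] with z hz
    rw [ENNReal.ofReal_toReal hz.ne]

theorem Measurable.randomIndex {Ω β : Type*} [MeasurableSpace Ω] [MeasurableSpace β]
    {f : ℕ → Ω → β} (hf : ∀ i, Measurable (f i)) {N : Ω → ℕ} (hN : Measurable N) :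
    Measurable fun ω => f (N ω) ω :=
  (measurable_from_prod_countable_right (f := fun x : ℕ × Ω => f x.1 x.2) hf).comp
    (hN.prodMk measurable_id)

theorem measure_eq_tsum_inter_fiber {Ω : Type*} [MeasurableSpace Ω] (P : Measure Ω) {N : Ω → ℕ}
    (hN : Measurable N) (S : Set Ω) : P S = ∑' o, P (S ∩ N ⁻¹' {o}) := by
  have h := tsum_measure_preimage_singleton (μ := P.restrict S) Set.countable_univ
    fun o _ => hN (measurableSet_singleton o)
  rw [tsum_univ (fun o => P.restrict S (N ⁻¹' {o})), Set.preimage_univ,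
    Measure.restrict_apply_univ] at h
  rw [← h]
  refine tsum_congr fun o => ?_
  rw [Measure.restrict_apply (hN (measurableSet_singleton o)), Set.inter_comm]

/-- Fluctuations which are independent of the past remain i.i.d. and independent of the past when
the second one is drawn with a random index `N` determined by the past. -/
theorem map_restrict_prodMk_randomIndex {Ω β : Type*} {F mΩ : MeasurableSpace Ω}
    [MeasurableSpace β] {P : Measure Ω} [IsProbabilityMeasure P]
    (hF : F ≤ mΩ) {e : ℕ → Ω → ℝ} (he : ∀ i, Measurable (e i))
    (hind : Indep F (⨆ i, MeasurableSpace.comap (e i) inferInstance) P)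
    (hpair : ∀ i j, i ≠ j → P.map (fun ω => (e i ω, e j ω)) = noisePairLaw)
    {R : Set Ω} (hR : MeasurableSet[F] R) {N : Ω → ℕ} (hN : Measurable[F] N) (l : ℕ)
    (hne : ∀ᵐ ω ∂P, ω ∈ R → N ω ≠ l) {Y : Ω → β} (hY : Measurable[F] Y) :
    (P.restrict R).map (fun ω => (Y ω, (e l ω, e (N ω) ω))) =
      ((P.restrict R).map Y).prod noisePairLaw := by
  have hN' : Measurable N := hN.mono hF le_rfl
  have hY' : Measurable Y := hY.mono hF le_rfl
  have heN : Measurable fun ω => e (N ω) ω := Measurable.randomIndex he hN'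
  have hm : Measurable fun ω => (Y ω, (e l ω, e (N ω) ω)) := hY'.prodMk ((he l).prodMk heN)
  symm
  refine Measure.prod_eq fun s t hs ht => ?_
  rw [Measure.map_apply hm (hs.prod ht), Measure.map_apply hY' hs,
    Measure.restrict_apply ((hs.prod ht).preimage hm),
    Measure.restrict_apply (hs.preimage hY'), measure_eq_tsum_inter_fiber P hN',
    measure_eq_tsum_inter_fiber P hN' (Y ⁻¹' s ∩ R), ← ENNReal.tsum_mul_right]
  refine tsum_congr fun o => ?_
  by_cases ho : l = o
  · have h0 : P (R ∩ N ⁻¹' {o}) = 0 := by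
      refine measure_mono_null (fun ω hω => ?_) (ae_iff.1 hne)
      have : N ω = o := hω.2
      exact fun h => h hω.1 (this.trans ho.symm)
    rw [measure_mono_null _ h0, measure_mono_null _ h0, zero_mul]
    · exact fun ω hω => ⟨hω.1.2, hω.2⟩
    · exact fun ω hω => ⟨hω.1.2, hω.2⟩
  · have hset : ((fun ω => (Y ω, (e l ω, e (N ω) ω))) ⁻¹' s ×ˢ t ∩ R) ∩ N ⁻¹' {o} =
        ((Y ⁻¹' s ∩ R) ∩ N ⁻¹' {o}) ∩ (fun ω => (e l ω, e o ω)) ⁻¹' t := by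
      ext ω
      constructor
      · rintro ⟨⟨⟨h1, h2⟩, h3⟩, h4⟩
        have h4' : N ω = o := h4
        subst h4'
        exact ⟨⟨⟨h1, h3⟩, rfl⟩, h2⟩
      · rintro ⟨⟨⟨h1, h3⟩, h4⟩, h2⟩
        have h4' : N ω = o := h4
        subst h4'
        exact ⟨⟨⟨h1, h2⟩, h3⟩, rfl⟩
    have hle : ∀ i, MeasurableSpace.comap (e i) inferInstance ≤
        ⨆ i, MeasurableSpace.comap (e i) inferInstance :=
      le_iSup fun i => MeasurableSpace.comap (e i) inferInstance
    have hi : ∀ i, Measurable[⨆ i, MeasurableSpace.comap (e i) inferInstance] (e i) :=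
      fun i => (comap_measurable (e i)).mono (hle i) le_rfl
    have hp : Measurable[⨆ i, MeasurableSpace.comap (e i) inferInstance]
        (fun ω => (e l ω, e o ω)) := (hi l).prodMk (hi o)
    rw [hset, (Indep_iff _ _ P).1 hind _ _
      (((hY hs).inter hR).inter (hN (measurableSet_singleton o))) (hp ht), ← hpair l o ho,
      Measure.map_apply ((he l).prodMk (he o)) ht]

namespace Arena

variable {Ω : Type*}

theorem measurable_performance [MeasurableSpace Ω] {A : Arena Ω} {l q k : ℕ}
    (ha : Measurable (A.attr l)) (he : Measurable (A.noise l q k)) :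
    Measurable (A.performance l q k) :=
  measurable_perf ha he

theorem measurableSet_wins [MeasurableSpace Ω] {A : Arena Ω} {q k : ℕ}
    (ha : ∀ l, Measurable (A.attr l)) (he : ∀ l, Measurable (A.noise l q k)) {N : Ω → ℕ}
    (hN : Measurable N) (l : ℕ) : MeasurableSet {ω | A.Wins l (N ω) q k ω} := by
  have h1 : Measurable (A.performance l q k) := measurable_performance (ha l) (he l)
  have h2 : Measurable fun ω => A.performance (N ω) q k ω :=
    Measurable.randomIndex (fun i => measurable_performance (ha i) (he i)) hN
  exact (measurableSet_lt h2 h1).union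
    ((measurableSet_eq_fun h2 h1).inter (measurableSet_lt hN measurable_const))

theorem measurable_state [MeasurableSpace Ω] {A : Arena Ω} {m n q k : ℕ}
    (ha : ∀ l, Measurable (A.attr l)) (he : ∀ l, ∀ k' < k, Measurable (A.noise l q k'))
    (ho : ∀ l, ∀ k' < k, Measurable (A.opponent l q k')) (l : ℕ) :
    Measurable fun ω => A.state m n q k ω l := by
  induction k with
  | zero => exact measurable_const
  | succ k ih =>
    have hs := ih (fun l k' h => he l k' (h.trans k.lt_succ_self))
      (fun l k' h => ho l k' (h.trans k.lt_succ_self))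
    simp only [state]
    refine Measurable.ite ?_ (Measurable.ite ?_ ?_ ?_) hs
    · exact (measurableSet_lt hs.fst measurable_const).inter
        (measurableSet_lt hs.snd measurable_const)
    · exact measurableSet_wins ha (fun l => he l k k.lt_succ_self) (ho l k k.lt_succ_self) l
    · exact (hs.fst.add_const 1).prodMk hs.snd
    · exact hs.fst.prodMk (hs.snd.add_const 1)

section Past

variable {A : Arena Ω} {q k : ℕ}

theorem measurable_attr_past (l : ℕ) : Measurable[A.past q k] (A.attr l) :=
  (comap_measurable (A.attr l)).mono
    ((le_iSup (fun l => MeasurableSpace.comap (A.attr l) inferInstance) l).trans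
      (le_sup_left.trans le_sup_left)) le_rfl

theorem measurable_noise_past (l : ℕ) {k' : ℕ} (h : k' < k) :
    Measurable[A.past q k] (A.noise l q k') := by
  refine (comap_measurable (A.noise l q k')).mono (le_trans ?_ (le_sup_right.trans le_sup_left))
    le_rfl
  exact le_iSup_of_le l (le_iSup_of_le q (le_iSup_of_le k' (le_iSup_of_le
    (Or.inr ⟨rfl, h⟩) le_rfl)))

theorem measurable_opponent_past (l : ℕ) {k' : ℕ} (h : k' ≤ k) :
    Measurable[A.past q k] (A.opponent l q k') := by
  refine (comap_measurable (A.opponent l q k')).mono (le_trans ?_ le_sup_right) le_rfl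
  exact le_iSup_of_le l (le_iSup_of_le q (le_iSup_of_le k' (le_iSup_of_le
    (Or.inr ⟨rfl, h⟩) le_rfl)))

theorem measurable_state_past (m n l : ℕ) :
    Measurable[A.past q k] fun ω => A.state m n q k ω l :=
  @measurable_state Ω (A.past q k) A m n q k measurable_attr_past
    (fun l _ h => measurable_noise_past l h) (fun l _ h => measurable_opponent_past l h.le) l

theorem measurableSet_reach_past (m n l q i j : ℕ) :
    MeasurableSet[A.past q (i + j)] (A.reach m n l q i j) :=
  measurable_state_past m n l (measurableSet_singleton (i, j))

end Past

variable [MeasurableSpace Ω] {A : Arena Ω} {P : Measure Ω} {m n : ℕ}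

/-- The attributes and the relative fluctuations of player `l` and his opponent in a match. -/
def matchData (A : Arena Ω) (l q k : ℕ) (ω : Ω) : ((ℝ × ℝ) × (ℝ × ℝ)) × (ℝ × ℝ) :=
  ((A.attr l ω, A.attr (A.opponent l q k ω) ω),
    (A.noise l q k ω, A.noise (A.opponent l q k ω) q k ω))

namespace IsArena

theorem measurable_attr (hA : A.IsArena P m n) (l : ℕ) : Measurable (A.attr l) :=
  (hA.measurable_strength l).prodMk (hA.measurable_coeff l)

theorem past_le (hA : A.IsArena P m n) (q k : ℕ) : A.past q k ≤ ‹MeasurableSpace Ω› := by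
  refine sup_le (sup_le (iSup_le fun l => (hA.measurable_attr l).comap_le) ?_) ?_
  · exact iSup_le fun l => iSup_le fun q' => iSup_le fun k' => iSup_le fun _ =>
      (hA.measurable_noise l q' k').comap_le
  · exact iSup_le fun l => iSup_le fun q' => iSup_le fun k' => iSup_le fun _ =>
      (hA.measurable_opponent l q' k').comap_le

theorem measurableSet_reach (hA : A.IsArena P m n) (l q i j : ℕ) :
    MeasurableSet (A.reach m n l q i j) :=
  hA.past_le q (i + j) _ (measurableSet_reach_past m n l q i j)

theorem map_noise_pair [IsProbabilityMeasure P] (hA : A.IsArena P m n) (q k : ℕ) {i j : ℕ}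
    (hij : i ≠ j) :
    P.map (fun ω => (A.noise i q k ω, A.noise j q k ω)) = noisePairLaw := by
  have h : IndepFun (A.noise i q k) (A.noise j q k) P :=
    hA.noise_indep.indepFun (i := (i, q, k)) (j := (j, q, k)) (by simpa using hij)
  rw [(indepFun_iff_map_prod_eq_prod_map_map (hA.measurable_noise i q k).aemeasurable
    (hA.measurable_noise j q k).aemeasurable).1 h, hA.noise_law, hA.noise_law, noisePairLaw]

theorem measurable_matchData (hA : A.IsArena P m n) (l q k : ℕ) :
    Measurable (A.matchData l q k) :=
  ((hA.measurable_attr l).prodMk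
    (Measurable.randomIndex hA.measurable_attr (hA.measurable_opponent l q k))).prodMk
    ((hA.measurable_noise l q k).prodMk
      (Measurable.randomIndex (fun l => hA.measurable_noise l q k) (hA.measurable_opponent l q k)))

/-- The probability measure conditioned on reaching a state carries independent strengths
and coefficients of the two opponents, and fresh independent fluctuations. -/
theorem map_match_eq [IsProbabilityMeasure P] (hA : A.IsArena P m n) {l q i j : ℕ} (hi : i < m)
    (hj : j < n) :
    (cond P (A.reach m n l q i j)).map (A.matchData l q (i + j)) =
      ((A.law P m n l q i j).prod (A.law P m n l q i j)).prod noisePairLaw := by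
  have ho := hA.measurable_opponent l q (i + j)
  have hao : Measurable fun ω => A.attr (A.opponent l q (i + j) ω) ω :=
    Measurable.randomIndex hA.measurable_attr ho
  have hao' : Measurable[A.past q (i + j)] fun ω => A.attr (A.opponent l q (i + j) ω) ω :=
    @Measurable.randomIndex _ _ (A.past q (i + j)) _ _ measurable_attr_past _
      (measurable_opponent_past l le_rfl)
  have hne : ∀ᵐ ω ∂P, ω ∈ A.reach m n l q i j → A.opponent l q (i + j) ω ≠ l := by
    filter_upwards [hA.matching q (i + j)] with ω hω hr
    have hr' : A.state m n q (i + j) ω l = (i, j) := hr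
    exact (hω l (by rw [hr']; exact hi) (by rw [hr']; exact hj)).1
  have h := map_restrict_prodMk_randomIndex (hA.past_le q (i + j))
    (fun l => hA.measurable_noise l q (i + j)) (hA.noise_fresh q (i + j))
    (fun _ _ => hA.map_noise_pair q (i + j)) (measurableSet_reach_past m n l q i j)
    (measurable_opponent_past l le_rfl) l hne ((measurable_attr_past l).prodMk hao')
  obtain ⟨hind, hid⟩ := hA.random_assignment l q i j hi hj
  rw [indepFun_iff_map_prod_eq_prod_map_map (hA.measurable_attr l).aemeasurable
    hao.aemeasurable, hid.map_eq] at hind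
  rw [law, ← hind, ProbabilityTheory.cond, Measure.map_smul, Measure.map_smul,
    Measure.prod_smul_left, ← h]
  rfl

end IsArena
end Arena

/-- Induction over the reachable states of an `m`-`n` arena. -/
theorem arena_induction {m n : ℕ} (hm : 1 ≤ m) (hn : 1 ≤ n) {C : ℕ → ℕ → Prop} (h0 : C 0 0)
    (hleft : ∀ i j, i < m → j < n → (i + 1 = m ∨ j = 0) → C i j → C (i + 1) j)
    (hright : ∀ i j, i < m → j < n → (j + 1 = n ∨ i = 0) → C i j → C i (j + 1))
    (hmid : ∀ i j, i + 1 < m → j + 1 < n → C i (j + 1) → C (i + 1) j → C (i + 1) (j + 1)) :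
    ∀ i j, i ≤ m → j ≤ n → (i, j) ≠ (m, n) → C i j := by
  have key : ∀ k i j, i + j = k → i ≤ m → j ≤ n → (i, j) ≠ (m, n) → C i j := by
    intro k
    induction k with
    | zero =>
      intro i j hk _ _ _
      obtain ⟨rfl, rfl⟩ : i = 0 ∧ j = 0 := by omega
      exact h0
    | succ k ih =>
      intro i j hk hi hj hne
      simp only [ne_eq, Prod.mk.injEq] at hne ih
      rcases i with _ | i
      · obtain ⟨j, rfl⟩ : ∃ j', j = j' + 1 := ⟨j - 1, by omega⟩
        exact hright 0 j (by omega) (by omega) (Or.inr rfl) (ih _ _ (by omega) (by omega)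
          (by omega) (by omega))
      · by_cases hj0 : j = 0 ∨ i + 1 = m
        · exact hleft i j (by omega) (by omega) (by omega) (ih _ _ (by omega) (by omega)
            (by omega) (by omega))
        · obtain ⟨j, rfl⟩ : ∃ j', j = j' + 1 := ⟨j - 1, by omega⟩
          by_cases hjn : j + 1 = n
          · exact hright (i + 1) j (by omega) (by omega) (Or.inl hjn) (ih _ _ (by omega)
              (by omega) (by omega) (by omega))
          · exact hmid i j (by omega) (by omega)
              (ih _ _ (by omega) (by omega) (by omega) (by omega))
              (ih _ _ (by omega) (by omega) (by omega) (by omega))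
  exact fun i j => key _ i j rfl

theorem choose_mul_mix_left (i j : ℕ) :
    ENNReal.ofReal (((i : ℝ) + 1) / ((i : ℝ) + 1 + ((j : ℝ) + 1))) *
      ((i + 1 + (j + 1)).choose (i + 1) : ℝ≥0∞) = ((i + (j + 1)).choose i : ℝ≥0∞) := by
  have h := Nat.add_one_mul_choose_eq (i + (j + 1)) i
  rw [show i + (j + 1) + 1 = i + 1 + (j + 1) by omega] at h
  have h' : ((i : ℝ) + 1 + (j + 1)) * ((i + (j + 1)).choose i : ℝ) =
      ((i + 1 + (j + 1)).choose (i + 1) : ℝ) * (i + 1) := by exact_mod_cast h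
  rw [← ENNReal.ofReal_natCast, ← ENNReal.ofReal_natCast, ← ENNReal.ofReal_mul (by positivity)]
  congr 1
  field_simp
  linarith

theorem choose_mul_mix_right (i j : ℕ) :
    ENNReal.ofReal (((j : ℝ) + 1) / ((i : ℝ) + 1 + ((j : ℝ) + 1))) *
      ((i + 1 + (j + 1)).choose (i + 1) : ℝ≥0∞) = ((i + 1 + j).choose (i + 1) : ℝ≥0∞) := by
  have h := choose_mul_mix_left j i
  rw [Nat.choose_symm_add, Nat.choose_symm_add] at h
  rwa [add_comm ((i : ℝ) + 1), add_comm (i + 1) (j + 1), add_comm (i + 1) j]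

namespace Arena

variable {Ω : Type*}

/-- Player `l` is in the state `(i, j)` after `i + j` rounds and wins his next match. -/
def winEvent (A : Arena Ω) (m n l q i j : ℕ) : Set Ω :=
  A.reach m n l q i j ∩ {ω | A.Wins l (A.opponent l q (i + j) ω) q (i + j) ω}

/-- Player `l` is in the state `(i, j)` after `i + j` rounds and loses his next match. -/
def loseEvent (A : Arena Ω) (m n l q i j : ℕ) : Set Ω :=
  A.reach m n l q i j \ {ω | A.Wins l (A.opponent l q (i + j) ω) q (i + j) ω}

section Reach

variable {A : Arena Ω} {m n l q : ℕ}

theorem mem_winEvent {i j k : ℕ} (h : i + j = k) {ω : Ω} : ω ∈ A.winEvent m n l q i j ↔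
    A.state m n q k ω l = (i, j) ∧ A.Wins l (A.opponent l q k ω) q k ω := by
  subst h; rfl

theorem mem_loseEvent {i j k : ℕ} (h : i + j = k) {ω : Ω} : ω ∈ A.loseEvent m n l q i j ↔
    A.state m n q k ω l = (i, j) ∧ ¬ A.Wins l (A.opponent l q k ω) q k ω := by
  subst h; rfl

theorem mem_reach {i j k : ℕ} (h : i + j = k) {ω : Ω} : ω ∈ A.reach m n l q i j ↔
    A.state m n q k ω l = (i, j) := by
  subst h; rfl

theorem state_sum_le (k : ℕ) (ω : Ω) :
    (A.state m n q k ω l).1 + (A.state m n q k ω l).2 ≤ k := by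
  induction k with
  | zero => simp [state]
  | succ k ih =>
    simp only [state]
    split_ifs <;> omega

theorem state_succ_eq_iff {a b k : ℕ} (h : a + b = k + 1) {ω : Ω} :
    A.state m n q (k + 1) ω l = (a, b) ↔
      (∃ i, a = i + 1 ∧ i < m ∧ b < n ∧ ω ∈ A.winEvent m n l q i b) ∨
      (∃ j, b = j + 1 ∧ a < m ∧ j < n ∧ ω ∈ A.loseEvent m n l q a j) := by
  have hsum := state_sum_le (A := A) (m := m) (n := n) (q := q) (l := l) k ω
  constructor
  · intro hs
    simp only [state] at hs
    split_ifs at hs with h1 h2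
    · simp only [Prod.mk.injEq] at hs
      obtain ⟨rfl, rfl⟩ := hs
      exact Or.inl ⟨_, rfl, h1.1, h1.2, (mem_winEvent (by omega)).2 ⟨rfl, h2⟩⟩
    · simp only [Prod.mk.injEq] at hs
      obtain ⟨rfl, rfl⟩ := hs
      exact Or.inr ⟨_, rfl, h1.1, h1.2, (mem_loseEvent (by omega)).2 ⟨rfl, h2⟩⟩
    · rw [hs] at hsum
      simp only at hsum
      omega
  · rintro (⟨i, rfl, hi, hb, hω⟩ | ⟨j, rfl, ha, hj, hω⟩)
    · rw [mem_winEvent (show i + b = k by omega)] at hω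
      simp [state, hω.1, hω.2, hi, hb]
    · rw [mem_loseEvent (show a + j = k by omega)] at hω
      simp [state, hω.1, hω.2, ha, hj]

theorem reach_zero_zero : A.reach m n l q 0 0 = Set.univ :=
  Set.eq_univ_of_forall fun _ => rfl

theorem reach_succ_left {i j : ℕ} (hi : i < m) (hj : j < n) (h : i + 1 = m ∨ j = 0) :
    A.reach m n l q (i + 1) j = A.winEvent m n l q i j := by
  ext ω
  rw [mem_reach (show i + 1 + j = i + j + 1 by omega), state_succ_eq_iff (by omega)]
  constructor
  · rintro (⟨i', hi', -, -, hω⟩ | ⟨j', hj', hm, -, -⟩)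
    · obtain rfl : i = i' := by omega
      exact hω
    · omega
  · exact fun hω => Or.inl ⟨i, rfl, hi, hj, hω⟩

theorem reach_succ_right {i j : ℕ} (hi : i < m) (hj : j < n) (h : j + 1 = n ∨ i = 0) :
    A.reach m n l q i (j + 1) = A.loseEvent m n l q i j := by
  ext ω
  rw [mem_reach (show i + (j + 1) = i + j + 1 by omega), state_succ_eq_iff (by omega)]
  constructor
  · rintro (⟨i', hi', -, hn, -⟩ | ⟨j', hj', -, -, hω⟩)
    · omega
    · obtain rfl : j = j' := by omega
      exact hω
  · exact fun hω => Or.inr ⟨j, rfl, hi, hj, hω⟩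

theorem reach_succ_succ {i j : ℕ} (hi : i + 1 < m) (hj : j + 1 < n) :
    A.reach m n l q (i + 1) (j + 1) =
      A.winEvent m n l q i (j + 1) ∪ A.loseEvent m n l q (i + 1) j := by
  ext ω
  rw [mem_reach (show i + 1 + (j + 1) = i + j + 1 + 1 by omega), state_succ_eq_iff (by omega)]
  constructor
  · rintro (⟨i', hi', -, -, hω⟩ | ⟨j', hj', -, -, hω⟩)
    · obtain rfl : i = i' := by omega
      exact Or.inl hω
    · obtain rfl : j = j' := by omega
      exact Or.inr hω
  · rintro (hω | hω)
    · exact Or.inl ⟨i, rfl, by omega, hj, hω⟩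
    · exact Or.inr ⟨j, rfl, hi, by omega, hω⟩

theorem disjoint_winEvent_loseEvent {i j : ℕ} :
    Disjoint (A.winEvent m n l q i (j + 1)) (A.loseEvent m n l q (i + 1) j) := by
  refine Set.disjoint_left.2 fun ω h1 h2 => ?_
  rw [mem_winEvent (show i + (j + 1) = i + 1 + j by omega)] at h1
  rw [mem_loseEvent rfl, h1.1] at h2
  simp at h2

end Reach

namespace IsArena

variable [MeasurableSpace Ω] {A : Arena Ω} {P : Measure Ω} {m n : ℕ}

theorem measurableSet_winning (hA : A.IsArena P m n) (l q k : ℕ) :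
    MeasurableSet {ω | A.Wins l (A.opponent l q k ω) q k ω} :=
  measurableSet_wins hA.measurable_attr (fun l => hA.measurable_noise l q k)
    (hA.measurable_opponent l q k) l

theorem measurableSet_loseEvent (hA : A.IsArena P m n) (l q i j : ℕ) :
    MeasurableSet (A.loseEvent m n l q i j) :=
  (hA.measurableSet_reach l q i j).diff (hA.measurableSet_winning l q _)

theorem law_eq_smul_map (A : Arena Ω) (P : Measure Ω) (m n l q i j : ℕ) :
    A.law P m n l q i j = (P (A.reach m n l q i j))⁻¹ •
      (P.restrict (A.reach m n l q i j)).map (A.attr l) := by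
  rw [law, ProbabilityTheory.cond, Measure.map_smul]

theorem law_absolutelyContinuous (hA : A.IsArena P m n) (l q i j : ℕ) :
    A.law P m n l q i j ≪ P.map (A.attr l) :=
  cond_absolutelyContinuous.map (hA.measurable_attr l)

theorem ae_law_pos (hA : A.IsArena P m n) (l q i j : ℕ) :
    ∀ᵐ z ∂A.law P m n l q i j, 0 < z.2 := by
  refine (hA.law_absolutelyContinuous l q i j).ae_le ?_
  have hS : MeasurableSet {z : ℝ × ℝ | 0 < z.2} := measurableSet_lt measurable_const measurable_snd
  exact (ae_map_iff (hA.measurable_attr l).aemeasurable hS).2 (hA.coeff_pos l)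

variable [IsProbabilityMeasure P]

theorem isProbabilityMeasure_law (hA : A.IsArena P m n) {l q i j : ℕ}
    (h : P (A.reach m n l q i j) ≠ 0) : IsProbabilityMeasure (A.law P m n l q i j) :=
  have := cond_isProbabilityMeasure h
  Measure.isProbabilityMeasure_map (hA.measurable_attr l).aemeasurable

theorem map_restrict_reach_inter (hA : A.IsArena P m n) {l q i j : ℕ} (hi : i < m)
    (hj : j < n) {E : Set Ω}
    {D : Set (((ℝ × ℝ) × (ℝ × ℝ)) × (ℝ × ℝ))} (hD : MeasurableSet D)
    (hED : ∀ᵐ ω ∂cond P (A.reach m n l q i j), ω ∈ E ↔ A.matchData l q (i + j) ω ∈ D)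
    {μ : Measure (ℝ × ℝ)} (hμ : ∀ S, MeasurableSet S →
      2 * ((A.law P m n l q i j).prod (A.law P m n l q i j)).prod noisePairLaw
        {x | x.1.1 ∈ S ∧ x ∈ D} = μ S) :
    (P.restrict (A.reach m n l q i j ∩ E)).map (A.attr l) =
      (P (A.reach m n l q i j) * 2⁻¹) • μ := by
  have hR := hA.measurableSet_reach l q i j
  have hg := hA.measurable_matchData l q (i + j)
  ext S hS
  have hT : MeasurableSet {x : ((ℝ × ℝ) × (ℝ × ℝ)) × (ℝ × ℝ) | x.1.1 ∈ S ∧ x ∈ D} :=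
    (hS.preimage (measurable_fst.comp measurable_fst)).inter hD
  have hQ : cond P (A.reach m n l q i j) (A.attr l ⁻¹' S ∩ E) = 2⁻¹ * μ S := by
    rw [← hμ S hS, ← mul_assoc, ENNReal.inv_mul_cancel two_ne_zero (by simp), one_mul,
      ← hA.map_match_eq hi hj, Measure.map_apply hg hT]
    refine measure_congr (Filter.eventuallyEq_set.2 ?_)
    filter_upwards [hED] with ω hω
    exact and_congr_right fun _ => hω
  rw [Measure.map_apply (hA.measurable_attr l) hS,
    Measure.restrict_apply (hS.preimage (hA.measurable_attr l)), Measure.smul_apply, smul_eq_mul,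
    mul_assoc, ← hQ, mul_comm, cond_mul_eq_inter hR, Set.inter_left_comm]

theorem ae_no_tie (hA : A.IsArena P m n) {l q i j : ℕ} (hi : i < m) (hj : j < n)
    (h : P (A.reach m n l q i j) ≠ 0) :
    ∀ᵐ ω ∂cond P (A.reach m n l q i j), A.performance l q (i + j) ω ≠
      A.performance (A.opponent l q (i + j) ω) q (i + j) ω := by
  have := hA.isProbabilityMeasure_law h
  have h0 := prod_tie_eq_zero (hA.ae_law_pos l q i j)
  have hT : MeasurableSet {x : ((ℝ × ℝ) × (ℝ × ℝ)) × (ℝ × ℝ) |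
      perf x.1.1 x.2.1 = perf x.1.2 x.2.2} :=
    measurableSet_eq_fun (by fun_prop) (by fun_prop)
  rw [← hA.map_match_eq hi hj, Measure.map_apply (hA.measurable_matchData l q (i + j)) hT] at h0
  rw [ae_iff]
  simp only [ne_eq, not_not]
  exact h0

theorem map_restrict_winEvent (hA : A.IsArena P m n) {l q i j : ℕ} (hi : i < m) (hj : j < n)
    (h : P (A.reach m n l q i j) ≠ 0) :
    (P.restrict (A.winEvent m n l q i j)).map (A.attr l) =
      (P (A.reach m n l q i j) * 2⁻¹) • winMeasure (A.law P m n l q i j) := by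
  have := hA.isProbabilityMeasure_law h
  refine hA.map_restrict_reach_inter hi hj
    (D := {x | perf x.1.2 x.2.2 < perf x.1.1 x.2.1})
    (measurableSet_lt (by fun_prop) (by fun_prop)) ?_
    fun S hS => two_mul_prod_win_eq (hA.ae_law_pos l q i j) hS
  filter_upwards [hA.ae_no_tie hi hj h] with ω hω
  exact or_iff_left fun h => hω h.1.symm

theorem map_restrict_loseEvent (hA : A.IsArena P m n) {l q i j : ℕ} (hi : i < m) (hj : j < n)
    (h : P (A.reach m n l q i j) ≠ 0) :
    (P.restrict (A.loseEvent m n l q i j)).map (A.attr l) =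
      (P (A.reach m n l q i j) * 2⁻¹) • loseMeasure (A.law P m n l q i j) := by
  have := hA.isProbabilityMeasure_law h
  rw [loseEvent, Set.sdiff_eq]
  refine hA.map_restrict_reach_inter hi hj
    (D := {x | perf x.1.1 x.2.1 < perf x.1.2 x.2.2})
    (measurableSet_lt (by fun_prop) (by fun_prop)) ?_
    fun S hS => two_mul_prod_lose_eq (hA.ae_law_pos l q i j) hS
  filter_upwards [hA.ae_no_tie hi hj h] with ω hω
  have hw : A.Wins l (A.opponent l q (i + j) ω) q (i + j) ω ↔
      A.performance (A.opponent l q (i + j) ω) q (i + j) ω < A.performance l q (i + j) ω :=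
    or_iff_left fun h => hω h.1.symm
  rw [Set.mem_compl_iff, Set.mem_ofPred_eq, hw, not_lt]
  exact ⟨fun h => lt_of_le_of_ne h hω, le_of_lt⟩

theorem prob_winEvent (hA : A.IsArena P m n) {l q i j : ℕ} (hi : i < m) (hj : j < n)
    (h : P (A.reach m n l q i j) ≠ 0) :
    P (A.winEvent m n l q i j) = P (A.reach m n l q i j) * 2⁻¹ := by
  have := hA.isProbabilityMeasure_law h
  have h1 := congrArg (fun μ => μ Set.univ) (hA.map_restrict_winEvent hi hj h)
  simpa [Measure.map_apply (hA.measurable_attr l) .univ,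
    winMeasure_univ (hA.ae_law_pos l q i j)] using h1

theorem prob_loseEvent (hA : A.IsArena P m n) {l q i j : ℕ} (hi : i < m) (hj : j < n)
    (h : P (A.reach m n l q i j) ≠ 0) :
    P (A.loseEvent m n l q i j) = P (A.reach m n l q i j) * 2⁻¹ := by
  have := hA.isProbabilityMeasure_law h
  have h1 := congrArg (fun μ => μ Set.univ) (hA.map_restrict_loseEvent hi hj h)
  simpa [Measure.map_apply (hA.measurable_attr l) .univ,
    loseMeasure_univ (hA.ae_law_pos l q i j)] using h1

theorem prob_reach (hA : A.IsArena P m n) (l q : ℕ) : ∀ i j, i < m → j < n →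
    P (A.reach m n l q i j) = ((i + j).choose i : ℝ≥0∞) * 2⁻¹ ^ (i + j) := by
  have hne : ∀ {i j : ℕ}, P (A.reach m n l q i j) = ((i + j).choose i : ℝ≥0∞) * 2⁻¹ ^ (i + j) →
      P (A.reach m n l q i j) ≠ 0 := by
    intro i j h
    rw [h]
    refine mul_ne_zero ?_ (pow_ne_zero _ (by simp))
    exact_mod_cast (Nat.choose_pos (Nat.le_add_right i j)).ne'
  intro i
  induction i with
  | zero =>
    intro j
    induction j with
    | zero => simp [reach_zero_zero]
    | succ j ih =>
      intro hm hj
      have h := ih hm (by omega)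
      rw [reach_succ_right hm (by omega) (Or.inr rfl),
        hA.prob_loseEvent hm (by omega) (hne h), h]
      simp [pow_succ]
  | succ i ihi =>
    intro j
    induction j with
    | zero =>
      intro hi hn
      have h := ihi 0 (by omega) hn
      rw [reach_succ_left (by omega) hn (Or.inr rfl),
        hA.prob_winEvent (by omega) hn (hne h), h]
      simp [pow_succ]
    | succ j ihj =>
      intro hi hj
      have h1 := ihi (j + 1) (by omega) hj
      have h2 := ihj hi (by omega)
      rw [reach_succ_succ hi hj, measure_union disjoint_winEvent_loseEvent
        (hA.measurableSet_loseEvent l q _ _), hA.prob_winEvent (by omega) hj (hne h1),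
        hA.prob_loseEvent hi (by omega) (hne h2), h1, h2,
        show i + 1 + (j + 1) = i + (j + 1) + 1 by omega, Nat.choose_succ_succ,
        show i + 1 + j = i + (j + 1) by omega, pow_succ]
      push_cast
      ring

theorem prob_reach_ne_zero_of_lt (hA : A.IsArena P m n) {l q i j : ℕ} (hi : i < m) (hj : j < n) :
    P (A.reach m n l q i j) ≠ 0 := by
  rw [hA.prob_reach l q i j hi hj]
  refine mul_ne_zero ?_ (pow_ne_zero _ (by simp))
  exact_mod_cast (Nat.choose_pos (Nat.le_add_right i j)).ne'

theorem prob_reach_ne_zero (hA : A.IsArena P m n) (hm : 1 ≤ m) (hn : 1 ≤ n) (l q : ℕ) :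
    ∀ i j, i ≤ m → j ≤ n → (i, j) ≠ (m, n) → P (A.reach m n l q i j) ≠ 0 := by
  refine arena_induction hm hn (hA.prob_reach_ne_zero_of_lt hm hn) ?_ ?_
    fun i j hi hj _ _ => hA.prob_reach_ne_zero_of_lt hi hj
  · intro i j hi hj h h'
    rw [reach_succ_left hi hj h, hA.prob_winEvent hi hj h']
    exact mul_ne_zero h' (by simp)
  · intro i j hi hj h h'
    rw [reach_succ_right hi hj h, hA.prob_loseEvent hi hj h']
    exact mul_ne_zero h' (by simp)

theorem law_succ_left (hA : A.IsArena P m n) (l q : ℕ) {i j : ℕ} (hi : i < m) (hj : j < n)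
    (h : i + 1 = m ∨ j = 0) :
    A.law P m n l q (i + 1) j = winMeasure (A.law P m n l q i j) := by
  have h0 := hA.prob_reach_ne_zero_of_lt (l := l) (q := q) hi hj
  rw [law_eq_smul_map, reach_succ_left hi hj h, hA.map_restrict_winEvent hi hj h0,
    hA.prob_winEvent hi hj h0, smul_smul, ENNReal.inv_mul_cancel, one_smul]
  · exact mul_ne_zero h0 (by simp)
  · exact ENNReal.mul_ne_top (measure_ne_top _ _) (by simp)

theorem law_succ_right (hA : A.IsArena P m n) (l q : ℕ) {i j : ℕ} (hi : i < m) (hj : j < n)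
    (h : j + 1 = n ∨ i = 0) :
    A.law P m n l q i (j + 1) = loseMeasure (A.law P m n l q i j) := by
  have h0 := hA.prob_reach_ne_zero_of_lt (l := l) (q := q) hi hj
  rw [law_eq_smul_map, reach_succ_right hi hj h, hA.map_restrict_loseEvent hi hj h0,
    hA.prob_loseEvent hi hj h0, smul_smul, ENNReal.inv_mul_cancel, one_smul]
  · exact mul_ne_zero h0 (by simp)
  · exact ENNReal.mul_ne_top (measure_ne_top _ _) (by simp)

theorem law_succ_succ (hA : A.IsArena P m n) (l q : ℕ) {i j : ℕ} (hi : i + 1 < m)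
    (hj : j + 1 < n) :
    A.law P m n l q (i + 1) (j + 1) =
      ENNReal.ofReal (((i : ℝ) + 1) / ((i : ℝ) + 1 + ((j : ℝ) + 1))) •
        winMeasure (A.law P m n l q i (j + 1)) +
      ENNReal.ofReal (((j : ℝ) + 1) / ((i : ℝ) + 1 + ((j : ℝ) + 1))) •
        loseMeasure (A.law P m n l q (i + 1) j) := by
  have hi' : i < m := by omega
  have hj' : j < n := by omega
  have h0 := hA.prob_reach_ne_zero_of_lt (l := l) (q := q) hi hj
  have h1 := hA.prob_reach_ne_zero_of_lt (l := l) (q := q) hi' hj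
  have h2 := hA.prob_reach_ne_zero_of_lt (l := l) (q := q) hi hj'
  have e1 : P (A.reach m n l q i (j + 1)) * 2⁻¹ =
      ENNReal.ofReal (((i : ℝ) + 1) / ((i : ℝ) + 1 + ((j : ℝ) + 1))) *
        P (A.reach m n l q (i + 1) (j + 1)) := by
    rw [hA.prob_reach l q _ _ hi' hj, hA.prob_reach l q _ _ hi hj, ← mul_assoc,
      choose_mul_mix_left, show i + 1 + (j + 1) = i + (j + 1) + 1 by omega, pow_succ, mul_assoc]
  have e2 : P (A.reach m n l q (i + 1) j) * 2⁻¹ =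
      ENNReal.ofReal (((j : ℝ) + 1) / ((i : ℝ) + 1 + ((j : ℝ) + 1))) *
        P (A.reach m n l q (i + 1) (j + 1)) := by
    rw [hA.prob_reach l q _ _ hi hj', hA.prob_reach l q _ _ hi hj, ← mul_assoc,
      choose_mul_mix_right, show i + 1 + (j + 1) = i + 1 + j + 1 by omega, pow_succ, mul_assoc]
  have hc : ∀ s : ℝ≥0∞, (P (A.reach m n l q (i + 1) (j + 1)))⁻¹ *
      (s * P (A.reach m n l q (i + 1) (j + 1))) = s := fun s => by
    rw [mul_left_comm, ENNReal.inv_mul_cancel h0 (measure_ne_top _ _), mul_one]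
  have hmap : (P.restrict (A.reach m n l q (i + 1) (j + 1))).map (A.attr l) =
      (P.restrict (A.winEvent m n l q i (j + 1))).map (A.attr l) +
        (P.restrict (A.loseEvent m n l q (i + 1) j)).map (A.attr l) := by
    rw [reach_succ_succ hi hj, Measure.restrict_union disjoint_winEvent_loseEvent
      (hA.measurableSet_loseEvent l q _ _), Measure.map_add _ _ (hA.measurable_attr l)]
  rw [law_eq_smul_map, hmap, hA.map_restrict_winEvent hi' hj h1,
    hA.map_restrict_loseEvent hi hj' h2, e1, e2, smul_add, smul_smul, smul_smul, hc, hc]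

theorem law_zero_zero (hA : A.IsArena P m n) (l q : ℕ) :
    A.law P m n l q 0 0 = P.map (A.attr 0) := by
  rw [law, reach_zero_zero, cond_univ, (hA.attr_ident l).map_eq]

theorem law_eq_law (hA : A.IsArena P m n) (hm : 1 ≤ m) (hn : 1 ≤ n) (l q l' q' : ℕ) :
    ∀ i j, i ≤ m → j ≤ n → (i, j) ≠ (m, n) →
      A.law P m n l q i j = A.law P m n l' q' i j := by
  refine arena_induction hm hn ?_ ?_ ?_ ?_
  · rw [hA.law_zero_zero, hA.law_zero_zero]
  · intro i j hi hj h h'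
    rw [hA.law_succ_left l q hi hj h, hA.law_succ_left l' q' hi hj h, h']
  · intro i j hi hj h h'
    rw [hA.law_succ_right l q hi hj h, hA.law_succ_right l' q' hi hj h, h']
  · intro i j hi hj h h'
    rw [hA.law_succ_succ l q hi hj, hA.law_succ_succ l' q' hi hj, h, h']

theorem isContinuousLaw_law (hA : A.IsArena P m n) (hm : 1 ≤ m) (hn : 1 ≤ n) {l q i j : ℕ}
    (hcont : IsContinuousLaw (A.law P m n l q 0 0)) (hi : i ≤ m) (hj : j ≤ n)
    (hij : (i, j) ≠ (m, n)) : IsContinuousLaw (A.law P m n l q i j) := by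
  have := hA.isProbabilityMeasure_law (hA.prob_reach_ne_zero hm hn l q i j hi hj hij)
  have := hA.isProbabilityMeasure_law (l := l) (q := q) (hA.prob_reach_ne_zero_of_lt hm hn)
  have h0 := isContinuousLaw_iff.1 hcont
  rw [hA.law_zero_zero, ← (hA.attr_ident l).map_eq] at h0
  exact isContinuousLaw_iff.2 ((hA.law_absolutelyContinuous l q i j).trans h0)

end IsArena
end Arena

theorem mainTheorem3 {Ω : Type*} [MeasurableSpace Ω] (P : Measure Ω) [IsProbabilityMeasure P]
    (m n : ℕ) (hm : 1 ≤ m) (hn : 1 ≤ n) (A : Arena Ω) (hA : A.IsArena P m n)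
    (hcont : ∀ l q, IsContinuousLaw (A.law P m n l q 0 0)) :
    -- the law of `(X_{i,j}, ρ_{i,j})` depends neither on the player nor on the run
    (∀ i j, i ≤ m → j ≤ n → (i, j) ≠ (m, n) → ∀ l q l' q',
      A.law P m n l q i j = A.law P m n l' q' i j) ∧
    (∀ i j, i ≤ m → j ≤ n → (i, j) ≠ (m, n) → ∀ l q,
      IsContinuousLaw (A.law P m n l q i j)) ∧
    -- the recursion, for arbitrary versions of the densities
    (∀ l q, ∀ p : ℕ → ℕ → ℝ × ℝ → ℝ,
      (∀ i j, i ≤ m → j ≤ n → (i, j) ≠ (m, n) → IsJointPDF (p i j) (A.law P m n l q i j)) →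
      (∀ i, 1 ≤ i → i ≤ m - 1 → ∀ᵐ z : ℝ × ℝ,
        p i 0 z = 2 * p (i - 1) 0 z * winIntegral (p (i - 1) 0) z.1 z.2) ∧
      (∀ j, 1 ≤ j → j ≤ n - 1 → ∀ᵐ z : ℝ × ℝ,
        p 0 j z = 2 * p 0 (j - 1) z * loseIntegral (p 0 (j - 1)) z.1 z.2) ∧
      (∀ i j, 1 ≤ i → i ≤ m - 1 → 1 ≤ j → j ≤ n - 1 → ∀ᵐ z : ℝ × ℝ,
        p i j z =
          2 * (i : ℝ) / ((i : ℝ) + (j : ℝ)) * p (i - 1) j z *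
              winIntegral (p (i - 1) j) z.1 z.2 +
          2 * (j : ℝ) / ((i : ℝ) + (j : ℝ)) * p i (j - 1) z *
              loseIntegral (p i (j - 1)) z.1 z.2) ∧
      (∀ j, j ≤ n - 1 → ∀ᵐ z : ℝ × ℝ,
        p m j z = 2 * p (m - 1) j z * winIntegral (p (m - 1) j) z.1 z.2) ∧
      (∀ i, i ≤ m - 1 → ∀ᵐ z : ℝ × ℝ,
        p i n z = 2 * p i (n - 1) z * loseIntegral (p i (n - 1)) z.1 z.2)) := by
  refine ⟨fun i j hi hj hij l q l' q' => hA.law_eq_law hm hn l q l' q' i j hi hj hij,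
    fun i j hi hj hij l q => hA.isContinuousLaw_law hm hn (hcont l q) hi hj hij, ?_⟩
  intro l q p hp
  have hlt : ∀ {i j}, i < m → j < n → IsJointPDF (p i j) (A.law P m n l q i j) :=
    fun hi hj => hp _ _ hi.le hj.le (by simp only [ne_eq, Prod.mk.injEq]; omega)
  have hpos := hA.ae_law_pos l q
  have hwin : ∀ i j, i < m → j < n → (i + 1 = m ∨ j = 0) → ∀ᵐ z : ℝ × ℝ,
      p (i + 1) j z = 2 * p i j z * winIntegral (p i j) z.1 z.2 := fun i j hi hj h =>
    (hlt hi hj).ae_eq_win (hp (i + 1) j hi hj.le (by simp only [ne_eq, Prod.mk.injEq]; omega))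
      (hpos i j) (hA.law_succ_left l q hi hj h)
  have hlose : ∀ i j, i < m → j < n → (j + 1 = n ∨ i = 0) → ∀ᵐ z : ℝ × ℝ,
      p i (j + 1) z = 2 * p i j z * loseIntegral (p i j) z.1 z.2 := fun i j hi hj h =>
    (hlt hi hj).ae_eq_lose (hp i (j + 1) hi.le hj (by simp only [ne_eq, Prod.mk.injEq]; omega))
      (hpos i j) (hA.law_succ_right l q hi hj h)
  refine ⟨?_, ?_, ?_, ?_, ?_⟩
  · intro i hi him
    obtain ⟨i, rfl⟩ := Nat.exists_eq_add_of_le' hi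
    exact hwin i 0 (by omega) (by omega) (Or.inr rfl)
  · intro j hj hjn
    obtain ⟨j, rfl⟩ := Nat.exists_eq_add_of_le' hj
    exact hlose 0 j (by omega) (by omega) (Or.inr rfl)
  · intro i j hi him hj hjn
    obtain ⟨i, rfl⟩ := Nat.exists_eq_add_of_le' hi
    obtain ⟨j, rfl⟩ := Nat.exists_eq_add_of_le' hj
    have h := IsJointPDF.ae_eq_mix (hlt (i := i) (j := j + 1) (by omega) (by omega))
      (hlt (i := i + 1) (j := j) (by omega) (by omega))
      (hlt (i := i + 1) (j := j + 1) (by omega) (by omega)) (hpos _ _) (hpos _ _)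
      (by positivity) (by positivity) (hA.law_succ_succ l q (by omega) (by omega))
    filter_upwards [h] with z hz
    simp only [Nat.add_sub_cancel, Nat.cast_add, Nat.cast_one]
    rw [hz]
    ring
  · intro j hj
    obtain ⟨m, rfl⟩ := Nat.exists_eq_add_of_le' hm
    exact hwin m j (by omega) (by omega) (Or.inl rfl)
  · intro i hi
    obtain ⟨n, rfl⟩ := Nat.exists_eq_add_of_le' hn
    exact hlose i n (by omega) (by omega) (Or.inl rfl)
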